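/- Let $J^\infty(\pi)$ be the infinite jet space of the trivial bundle $\pi:\mathbb R^2\times\mathbb R^m\to\mathbb R^2$, with coordinates $x,y,u^k_I$ ($1\le k\le m$, $I=(a,b)\in\mathbb N_0^2$ standing for $a$ symbols $x$ and $b$ symbols $y$, $|I|=a+b$). Let $\mathcal F(\pi)$ be the ring of differential functions, that is, smooth real functions on $J^\infty(\pi)$ depending on only finitely many coordinates. Let $D_x=\partial_x+\sum_{k,I}u^k_{I,x}\,\partial/\partial u^k_I$ and $D_y=\partial_y+\sum_{k,I}u^k_{I,y}\,\partial/\partial u^k_I$ be the total derivatives, and $D_I=D_x^aD_y^b$. Let $F^1,\dots,F^N\in\mathcal F(\pi)$ define a system $\mathcal E:\ F^l=0$, and let $\mathcal I(\mathcal E)\subset\mathcal F(\pi)$ be the ideal generated by all $D_IF^l$. Let $\mathfrak g\subset\mathfrak{gl}(n,\mathbb R)$ be a matrix Lie algebra, $\mathcal F^{\mathfrak g}(\pi)$ the Lie algebra of $\mathfrak g$-valued functions on $J^\infty(\pi)$ with entries in $\mathcal F(\pi)$ (derivatives act entrywise), $\mathcal I^{\mathfrak g}(\mathcal E)$ the ideal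 of those $M\in\mathcal F^{\mathfrak g}(\pi)$ all of whose entries lie in $\mathcal I(\mathcal E)$, and $M|_{\mathcal E}$ the class of $M$ in $\mathcal F^{\mathfrak g}(\mathcal E)=\mathcal F^{\mathfrak g}(\pi)/\mathcal I^{\mathfrak g}(\mathcal E)$. A $\mathfrak g$-valued zero-curvature representation (ZCR) of $\mathcal E$ is a pair $(A|_{\mathcal E},B|_{\mathcal E})$ with $A,B\in\mathcal F^{\mathfrak g}(\pi)$ and $(D_yA-D_xB+[A,B])|_{\mathcal E}=0$. A characteristic representative of it is a pair $(\tilde A,\tilde B)\in\mathcal F^{\mathfrak g}(\pi)^2$ with $\tilde A|_{\mathcal E}=A|_{\mathcal E}$, $\tilde B|_{\mathcal E}=B|_{\mathcal E}$ such that, for some $Q_1,\dots,Q_N\in\mathcal F^{\mathfrak g}(\pi)$, $$D_y\tilde A-D_x\tilde B+[\tilde A,\tilde B]=\sum_{l=1}^N F^lQ_l\quad\text{identically on }J^\infty(\pi).$$ Proposition. Let $(\tilde A,\tilde B)$ be a characteristic representative of a $\mathfrak g$-valued ZCR of $\mathcal E$. Put $\hat D_xM=D_xM-[\tilde A,M]$,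 $\hat D_yM=D_yM-[\tilde B,M]$, and $\hat D_I=\hat D_x^{\,a}\hat D_y^{\,b}$ for $I=(a,b)$. Then, for every $k=1,\dots,m$, $$\Big(\sum_{I}(-1)^{|I|}\,\hat D_I\,\frac{\partial}{\partial u^k_I}\big(D_y\tilde A-D_x\tilde B+[\tilde A,\tilde B]\big)\Big)\Big|_{\mathcal E}=0 .$$ -/

import Mathlib

open scoped ContDiff

attribute [local instance] LieRing.ofAssociativeRing

namespace ZCR

noncomputable section

/-! ### The infinite jet space and differential functions -/

/-- Coordinates on the infinite jet space of `ℝ² × ℝᵐ → ℝ²`: the independent variables `x`, `y`,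
and the jet variables `u k a b`, standing for `u^k_I` where the (symmetric) multiindex `I`
consists of `a` symbols `x` and `b` symbols `y`; its length is `|I| = a + b`. -/
inductive Coord (m : ℕ) : Type
  | x : Coord m
  | y : Coord m
  | u (k : Fin m) (a b : ℕ) : Coord m
  deriving DecidableEq

/-- The infinite jet space `J^∞(π)` of the trivial bundle `π : ℝ² × ℝᵐ → ℝ²`. -/
abbrev Jet (m : ℕ) : Type := Coord m → ℝ

/-- `f` is a smooth function of the finitely many coordinates in `S`. -/
def SmoothIn {m : ℕ} (S : Finset (Coord m)) (f : Jet m → ℝ) : Prop :=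
  ∃ g : (S → ℝ) → ℝ, ContDiff ℝ ∞ g ∧ ∀ θ : Jet m, f θ = g fun s => θ s

theorem SmoothIn.mono {m : ℕ} {S T : Finset (Coord m)} {f : Jet m → ℝ}
    (hf : SmoothIn S f) (h : S ⊆ T) : SmoothIn T f := by
  obtain ⟨g, hg, hfg⟩ := hf
  refine ⟨fun v => g fun s => v ⟨s, h s.2⟩, ?_, hfg⟩
  exact hg.comp (contDiff_pi.2 fun s => contDiff_apply ℝ ℝ _)

/-- The differential functions: smooth real-valued functions on the jet space depending on only
finitely many coordinates, as a subalgebra of all functions. -/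
def diffSubalgebra (m : ℕ) : Subalgebra ℝ (Jet m → ℝ) where
  carrier := {f | ∃ S : Finset (Coord m), SmoothIn S f}
  mul_mem' := by
    rintro f g ⟨S, hS⟩ ⟨T, hT⟩
    obtain ⟨p, hp, hfp⟩ := hS.mono (Finset.subset_union_left (s₂ := T))
    obtain ⟨q, hq, hgq⟩ := hT.mono (Finset.subset_union_right (s₁ := S))
    exact ⟨S ∪ T, fun v => p v * q v, hp.mul hq, fun θ => by simp [hfp, hgq]⟩
  add_mem' := by
    rintro f g ⟨S, hS⟩ ⟨T, hT⟩
    obtain ⟨p, hp, hfp⟩ := hS.mono (Finset.subset_union_left (s₂ := T))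
    obtain ⟨q, hq, hgq⟩ := hT.mono (Finset.subset_union_right (s₁ := S))
    exact ⟨S ∪ T, fun v => p v + q v, hp.add hq, fun θ => by simp [hfp, hgq]⟩
  algebraMap_mem' := fun r => ⟨∅, fun _ => r, contDiff_const, fun _ => rfl⟩

/-- The ring `𝓕(π)` of differential functions on the jet space, with pointwise operations. -/
def DiffFun (m : ℕ) : Type := diffSubalgebra m

instance (m : ℕ) : CommRing (DiffFun m) := inferInstanceAs (CommRing (diffSubalgebra m))

instance (m : ℕ) : Algebra ℝ (DiffFun m) := inferInstanceAs (Algebra ℝ (diffSubalgebra m))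

/-- A differential function is a function on the jet space. -/
instance (m : ℕ) : CoeFun (DiffFun m) fun _ => Jet m → ℝ := ⟨fun f => f.1⟩

/-- The coordinate function `c` as a differential function. -/
def coordFun {m : ℕ} (c : Coord m) : DiffFun m :=
  ⟨fun θ => θ c, {c}, fun v => v ⟨c, by simp⟩, contDiff_apply ℝ ℝ _, fun _ => rfl⟩

/-- A smooth function of the coordinates in `S` has, along each coordinate, a derivative, which
is smooth in the coordinates in `S` and is zero if the coordinate is not in `S`. -/
theorem SmoothIn.exists_partial {m : ℕ} {S : Finset (Coord m)} {f : Jet m → ℝ}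
    (hf : SmoothIn S f) (c : Coord m) :
    ∃ f' : Jet m → ℝ, SmoothIn S f' ∧ (c ∉ S → f' = 0) ∧
      ∀ θ, HasDerivAt (fun t => f (Function.update θ c t)) (f' θ) (θ c) := by
  classical
  obtain ⟨g, hg, hfg⟩ := hf
  let e : S → ℝ := fun s => if (s : Coord m) = c then 1 else 0
  refine ⟨fun θ => fderiv ℝ g (fun s => θ s) e,
    ⟨fun v => fderiv ℝ g v e, ?_, fun _ => rfl⟩, ?_, ?_⟩
  · exact (hg.fderiv_right (m := ∞) (by simp)).clm_apply contDiff_const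
  · intro hc
    have he : e = 0 := by
      funext s
      have : (s : Coord m) ≠ c := fun h => hc (h ▸ s.2)
      simp [e, this]
    funext θ
    simp [he]
  · intro θ
    have h1 : HasDerivAt (fun (t : ℝ) (s : S) => Function.update θ c t (s : Coord m)) e (θ c) := by
      rw [hasDerivAt_pi]
      intro s
      by_cases h : (s : Coord m) = c
      · have h0 : (fun t : ℝ => Function.update θ c t (s : Coord m)) = id := by
          funext t; simp [h]
        have h1 : e s = 1 := by simp [e, h]
        rw [h0, h1]
        exact hasDerivAt_id (θ c)
      · have h0 : (fun t : ℝ => Function.update θ c t (s : Coord m)) = fun _ => θ s := by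
          funext t; simp [h]
        have h1 : e s = 0 := by simp [e, h]
        rw [h0, h1]
        exact hasDerivAt_const (θ c) (θ s)
    have h2 : HasFDerivAt g (fderiv ℝ g fun s : S => θ s)
        (fun s : S => Function.update θ c (θ c) (s : Coord m)) := by
      simpa using ((hg.differentiable (by simp)) fun s : S => θ s).hasFDerivAt
    have h3 := h2.comp_hasDerivAt (θ c) h1
    simp only [hfg]
    exact h3

/-- The partial derivative `∂/∂c` along the coordinate `c`, as an operator on `𝓕(π)`. -/
def pd {m : ℕ} (c : Coord m) (f : DiffFun m) : DiffFun m :=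
  ⟨fun θ => deriv (fun t => f (Function.update θ c t)) (θ c), by
    obtain ⟨S, hS⟩ := f.2
    obtain ⟨f', h1, -, h3⟩ := hS.exists_partial c
    exact ⟨S, by simpa only [(h3 _).deriv] using h1⟩⟩

theorem hasDerivAt_pd {m : ℕ} (c : Coord m) (f : DiffFun m) (θ : Jet m) :
    HasDerivAt (fun t => f (Function.update θ c t))
      (pd c f θ) (θ c) := by
  obtain ⟨S, hS⟩ := f.2
  obtain ⟨f', -, -, h3⟩ := hS.exists_partial c
  exact (h3 θ).differentiableAt.hasDerivAt

/-- Only finitely many partial derivatives of a differential function are nonzero. -/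
theorem finite_pd {m : ℕ} (f : DiffFun m) : {c : Coord m | pd c f ≠ 0}.Finite := by
  obtain ⟨S, hS⟩ := f.2
  refine S.finite_toSet.subset fun c hc => ?_
  by_contra hcS
  obtain ⟨f', -, h2, h3⟩ := hS.exists_partial c
  refine hc (Subtype.ext (funext fun θ => ?_))
  have := (h3 θ).deriv
  rw [h2 hcS] at this
  exact this

/-- The total derivative `D_x = ∂/∂x + ∑_{k,I} u^k_{I,x} ∂/∂u^k_I`. The sum over all
`(k, a, b)`, with `I = (a, b)`, has only finitely many nonzero terms. -/
def Dx {m : ℕ} (f : DiffFun m) : DiffFun m :=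
  pd Coord.x f + ∑ᶠ i : Fin m × ℕ × ℕ,
    coordFun (Coord.u i.1 (i.2.1 + 1) i.2.2) * pd (Coord.u i.1 i.2.1 i.2.2) f

/-- The total derivative `D_y = ∂/∂y + ∑_{k,I} u^k_{I,y} ∂/∂u^k_I`. -/
def Dy {m : ℕ} (f : DiffFun m) : DiffFun m :=
  pd Coord.y f + ∑ᶠ i : Fin m × ℕ × ℕ,
    coordFun (Coord.u i.1 i.2.1 (i.2.2 + 1)) * pd (Coord.u i.1 i.2.1 i.2.2) f

/-! ### `𝔤`-valued functions on the jet space -/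

/-- Matrices of size `n` whose entries are differential functions. -/
abbrev MatFun (m n : ℕ) : Type := Matrix (Fin n) (Fin n) (DiffFun m)

/-- The value `M(θ)` of a matrix of differential functions at a point of the jet space. -/
def evalAt {m n : ℕ} (M : MatFun m n) (θ : Jet m) : Matrix (Fin n) (Fin n) ℝ :=
  M.map fun f => f θ

/-- Evaluation at a point of the jet space, as a ring homomorphism `𝓕(π) → ℝ`. -/
def evalHom {m : ℕ} (θ : Jet m) : DiffFun m →+* ℝ :=
  (Pi.evalRingHom (fun _ : Jet m => ℝ) θ).comp (diffSubalgebra m).val.toRingHom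

theorem evalAt_eq {m n : ℕ} (M : MatFun m n) (θ : Jet m) :
    evalAt M θ = (evalHom θ).mapMatrix M := rfl

/-- The Lie algebra `𝓕^𝔤(π)` of `𝔤`-valued functions: matrices of differential functions with
values in `𝔤`, with the commutator as Lie bracket (it is in fact a Lie algebra over `𝓕(π)`). -/
def GFun (m : ℕ) {n : ℕ} (𝔤 : LieSubalgebra ℝ (Matrix (Fin n) (Fin n) ℝ)) :
    LieSubalgebra (DiffFun m) (MatFun m n) where
  carrier := {M | ∀ θ, evalAt M θ ∈ 𝔤}
  add_mem' := by
    intro M N hM hN θ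
    have : evalAt (M + N) θ = evalAt M θ + evalAt N θ := by simp only [evalAt_eq, map_add]
    rw [this]
    exact add_mem (hM θ) (hN θ)
  zero_mem' := by
    intro θ
    have : evalAt (0 : MatFun m n) θ = 0 := by simp only [evalAt_eq, map_zero]
    rw [this]
    exact zero_mem _
  smul_mem' := by
    intro f M hM θ
    have : evalAt (f • M) θ = evalHom θ f • evalAt M θ := by
      ext i j
      simp [evalAt_eq]
    rw [this]
    exact 𝔤.smul_mem _ (hM θ)
  lie_mem' := by
    intro M N hM hN θ
    have : evalAt ⁅M, N⁆ θ = ⁅evalAt M θ, evalAt N θ⁆ := by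
      simp only [evalAt_eq, Ring.lie_def, map_sub, map_mul]
    rw [this]
    exact 𝔤.lie_mem (hM θ) (hN θ)

variable {m n : ℕ} {𝔤 : LieSubalgebra ℝ (Matrix (Fin n) (Fin n) ℝ)}

theorem map_pd_mem (c : Coord m) {M : MatFun m n} (hM : M ∈ GFun m 𝔤) :
    M.map (pd c) ∈ GFun m 𝔤 := by
  intro θ
  have hcl : IsClosed (𝔤.toSubmodule : Set (Matrix (Fin n) (Fin n) ℝ)) :=
    Submodule.closed_of_finiteDimensional _
  have key : Filter.Tendsto
      (fun t : ℝ => (t - θ c)⁻¹ • (evalAt M (Function.update θ c t) - evalAt M θ))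
      (nhdsWithin (θ c) {θ c}ᶜ) (nhds (evalAt (M.map (pd c)) θ)) := by
    refine tendsto_pi_nhds.2 fun i => tendsto_pi_nhds.2 fun j => ?_
    have := hasDerivAt_iff_tendsto_slope.1 (hasDerivAt_pd c (M i j) θ)
    refine this.congr fun t => ?_
    simp [slope, evalAt]
  refine hcl.mem_of_tendsto key (Filter.Eventually.of_forall fun t => ?_)
  exact 𝔤.toSubmodule.smul_mem _ (𝔤.toSubmodule.sub_mem (hM _) (hM _))

/-- A derivation-like combination `∂/∂c₀ + ∑_i g_i ∂/∂c_i` applied entrywise preserves `𝔤`-valued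
functions. -/
theorem map_total_mem {ι : Type*} (c₀ : Coord m) (g : ι → DiffFun m) (c : ι → Coord m)
    (hc : Function.Injective c) {M : MatFun m n} (hM : M ∈ GFun m 𝔤) :
    M.map (fun f => pd c₀ f + ∑ᶠ i, g i * pd (c i) f) ∈ GFun m 𝔤 := by
  classical
  have hfin : (⋃ i, ⋃ j, {s | pd (c s) (M i j) ≠ 0}).Finite :=
    Set.finite_iUnion fun i => Set.finite_iUnion fun j =>
      (finite_pd (M i j)).preimage hc.injOn
  have : M.map (fun f => pd c₀ f + ∑ᶠ i, g i * pd (c i) f)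
      = M.map (pd c₀) + ∑ s ∈ hfin.toFinset, g s • M.map (pd (c s)) := by
    ext1 i j
    rw [Matrix.add_apply, Matrix.sum_apply]
    simp only [Matrix.map_apply, Matrix.smul_apply, smul_eq_mul]
    congr 1
    refine finsum_eq_sum_of_support_subset _ fun s hs => ?_
    simp only [Set.Finite.coe_toFinset, Set.mem_iUnion]
    exact ⟨i, j, fun h => hs (by simp [h])⟩
  rw [this]
  exact add_mem (map_pd_mem _ hM)
    (sum_mem fun s _ => (GFun m 𝔤).smul_mem _ (map_pd_mem _ hM))

theorem u_injective : Function.Injective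
    fun i : Fin m × ℕ × ℕ => (Coord.u i.1 i.2.1 i.2.2 : Coord m) := by
  rintro ⟨k, a, b⟩ ⟨k', a', b'⟩ h
  simp at h
  simp [h]

/-- The partial derivative `∂/∂c` on `𝔤`-valued functions, taken entrywise. -/
def gpd (c : Coord m) (M : GFun m 𝔤) : GFun m 𝔤 :=
  ⟨(M : MatFun m n).map (pd c), map_pd_mem c M.2⟩

/-- The total derivative `D_x` on `𝔤`-valued functions, taken entrywise. -/
def gDx (M : GFun m 𝔤) : GFun m 𝔤 :=
  ⟨(M : MatFun m n).map Dx, map_total_mem _ _ _ u_injective M.2⟩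

/-- The total derivative `D_y` on `𝔤`-valued functions, taken entrywise. -/
def gDy (M : GFun m 𝔤) : GFun m 𝔤 :=
  ⟨(M : MatFun m n).map Dy, map_total_mem _ _ _ u_injective M.2⟩

/-- The operator `D̂_x^R = D_x - ad_R` on `𝔤`-valued functions. -/
def hatDx (R M : GFun m 𝔤) : GFun m 𝔤 := gDx M - ⁅R, M⁆

/-- The operator `D̂_y^R = D_y - ad_R` on `𝔤`-valued functions. -/
def hatDy (R M : GFun m 𝔤) : GFun m 𝔤 := gDy M - ⁅R, M⁆

/-- `D̂_I = (D̂_x^A)^a ∘ (D̂_y^B)^b` for the multiindex `I = (a, b)`. -/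
def hatD (A B : GFun m 𝔤) (a b : ℕ) (M : GFun m 𝔤) : GFun m 𝔤 :=
  (hatDx A)^[a] ((hatDy B)^[b] M)

/-- The gauge-theoretic analogue of the `k`-th Euler operator,
`∑_I (-1)^{|I|} D̂_I ∘ ∂/∂u^k_I`, the sum being over all multiindices `I = (a, b)`; only finitely
many terms are nonzero when it is applied to a `𝔤`-valued function. -/
def hatEuler (A B : GFun m 𝔤) (k : Fin m) (M : GFun m 𝔤) : GFun m 𝔤 :=
  ∑ᶠ I : ℕ × ℕ, (-1 : ℤ) ^ (I.1 + I.2) • hatD A B I.1 I.2 (gpd (Coord.u k I.1 I.2) M)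

/-- The Maurer-Cartan expression `D_y A - D_x B + [A, B]`. -/
def maurerCartan (A B : GFun m 𝔤) : GFun m 𝔤 := gDy A - gDx B + ⁅A, B⁆

/-! ### The equation `𝓔` and the functions on it -/

/-- The differential ideal `𝓘(𝓔)` of `𝓕(π)` generated by all total derivatives
`D_I F^l = D_x^a D_y^b F^l` of the left-hand sides of the system `F^l = 0`. -/
def eqIdeal {N : ℕ} (F : Fin N → DiffFun m) : Ideal (DiffFun m) :=
  Ideal.span {f | ∃ (l : Fin N) (a b : ℕ), f = Dx^[a] (Dy^[b] (F l))}

/-- The ideal `𝓘^𝔤(𝓔)` of `𝓕^𝔤(π)`: the `𝔤`-valued functions all of whose entries lie in the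
differential ideal `𝓘(𝓔)`. -/
def gIdeal (𝔤 : LieSubalgebra ℝ (Matrix (Fin n) (Fin n) ℝ)) {N : ℕ} (F : Fin N → DiffFun m) :
    LieIdeal (DiffFun m) (GFun m 𝔤) where
  carrier := {M | ∀ i j, (M : MatFun m n) i j ∈ eqIdeal F}
  add_mem' := fun hM hN i j => (eqIdeal F).add_mem (hM i j) (hN i j)
  zero_mem' := fun _ _ => (eqIdeal F).zero_mem
  smul_mem' := fun f _ hM i j => (eqIdeal F).mul_mem_left f (hM i j)
  lie_mem := by
    intro R M hM i j
    have : ((⁅R, M⁆ : GFun m 𝔤) : MatFun m n) i j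
        = ((R : MatFun m n) * (M : MatFun m n)) i j
          - ((M : MatFun m n) * (R : MatFun m n)) i j := rfl
    rw [this, Matrix.mul_apply, Matrix.mul_apply]
    exact (eqIdeal F).sub_mem
      ((eqIdeal F).sum_mem fun s _ => (eqIdeal F).mul_mem_left _ (hM s j))
      ((eqIdeal F).sum_mem fun s _ => (eqIdeal F).mul_mem_right _ (hM i s))

/-- The Lie algebra `𝓕^𝔤(𝓔) = 𝓕^𝔤(π) / 𝓘^𝔤(𝓔)` of `𝔤`-valued functions on `𝓔`. -/
abbrev GFunOn (𝔤 : LieSubalgebra ℝ (Matrix (Fin n) (Fin n) ℝ)) {N : ℕ}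
    (F : Fin N → DiffFun m) : Type :=
  GFun m 𝔤 ⧸ gIdeal 𝔤 F

/-- The restriction `M|_𝓔` of a `𝔤`-valued function: its class in `𝓕^𝔤(𝓔)`. -/
def restr {N : ℕ} (F : Fin N → DiffFun m) (M : GFun m 𝔤) : GFunOn 𝔤 F :=
  LieSubmodule.Quotient.mk M

/-- The pair `(α, β)` of `𝔤`-valued functions on `𝓔` is a `𝔤`-valued zero-curvature
representation: it has representatives satisfying the Maurer-Cartan condition on `𝓔`. (The
condition does not depend on the choice of the representatives.) -/
def IsZCR {N : ℕ} (F : Fin N → DiffFun m) (α β : GFunOn 𝔤 F) : Prop :=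
  ∃ A B : GFun m 𝔤, restr F A = α ∧ restr F B = β ∧ restr F (maurerCartan A B) = 0

/-- `(A, B)` is a characteristic representative of the zero-curvature representation `(α, β)`:
it is an extension of `(α, β)` to the jet space for which
`D_y A - D_x B + [A, B] = ∑_l F^l Q_l` holds identically on the jet space with some `𝔤`-valued
functions `Q_l`. -/
def IsCharRep {N : ℕ} (F : Fin N → DiffFun m) (α β : GFunOn 𝔤 F) (A B : GFun m 𝔤) : Prop :=
  restr F A = α ∧ restr F B = β ∧
    ∃ Q : Fin N → GFun m 𝔤, maurerCartan A B = ∑ l, F l • Q l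

end

end ZCR

/-!
Write `C = D_y A - D_x B + [A, B]`, `P_{a,b} = ∂A/∂u^k_{a,b}` and `R_{a,b} = ∂B/∂u^k_{a,b}`. The
total derivatives satisfy `[∂/∂u^k_{a,b}, D_x] = ∂/∂u^k_{a-1,b}`, and similarly for `D_y`. The
bracket terms of `∂C/∂u^k_{a,b}` are exactly those that turn total derivatives into covariant
ones (`gpd_maurerCartan`):
`∂C/∂u^k_{a,b} = (D̂_y P_{a,b} + P_{a,b-1}) - (D̂_x R_{a,b} + R_{a-1,b})`.

Apply `(-1)^{a+b} D̂_x^a D̂_y^b` and sum. The `A`-part is a telescoping sum in `b` and vanishes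
identically (`sum_hatD_gpd_y_eq_zero`). The `B`-part would telescope in `a` if `D̂_x` commuted with
`D̂_y^b`. The curvature identity `[D̂_x, D̂_y] = ad_C` (`hatDx_hatDy_sub`) measures the failure: since
`C = ∑_l F^l Q_l` has its entries in the differential ideal of the equation, and this ideal is
stable under total derivatives and hence under `D̂_x` and `D̂_y`, the error terms lie in the ideal
(`sum_hatD_gpd_x_mem`).

The calculus on the jet space rests on the commutator formula for vector fields `∑_c X_c ∂/∂c`
(`vectorField_commutator`). It gives both the commutation of the two total derivatives and their
commutators with the partial derivatives.
-/

namespace ZCR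

noncomputable section

variable {m n N : ℕ} {𝔤 : LieSubalgebra ℝ (Matrix (Fin n) (Fin n) ℝ)}

/-! ### Partial derivatives as commuting derivations -/

theorem DiffFun.ext {f g : DiffFun m} (h : ∀ θ, f θ = g θ) : f = g :=
  Subtype.ext (funext h)

theorem pd_apply_eq {c : Coord m} {f : DiffFun m} {θ : Jet m} {d : ℝ}
    (h : HasDerivAt (fun t => f (Function.update θ c t)) d (θ c)) : pd c f θ = d :=
  h.deriv

theorem pd_add (c : Coord m) (f g : DiffFun m) : pd c (f + g) = pd c f + pd c g :=
  DiffFun.ext fun θ => pd_apply_eq ((hasDerivAt_pd c f θ).add (hasDerivAt_pd c g θ))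

theorem pd_mul (c : Coord m) (f g : DiffFun m) : pd c (f * g) = pd c f * g + f * pd c g := by
  refine DiffFun.ext fun θ => pd_apply_eq ?_
  have h := (hasDerivAt_pd c f θ).mul (hasDerivAt_pd c g θ)
  rw [Function.update_eq_self] at h
  exact h

theorem pd_zero (c : Coord m) : pd c (0 : DiffFun m) = 0 := by
  simpa using pd_add c 0 0

theorem pd_one (c : Coord m) : pd c (1 : DiffFun m) = 0 := by
  simpa using pd_mul c 1 1

theorem pd_coordFun_self (c : Coord m) : pd c (coordFun c) = 1 := by
  refine DiffFun.ext fun θ => pd_apply_eq ?_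
  refine (hasDerivAt_id (θ c)).congr_of_eventuallyEq (Filter.Eventually.of_forall fun t => ?_)
  simp [coordFun]

theorem pd_coordFun_of_ne {c d : Coord m} (h : d ≠ c) : pd c (coordFun d) = 0 := by
  refine DiffFun.ext fun θ => pd_apply_eq ?_
  refine (hasDerivAt_const (θ c) (θ d)).congr_of_eventuallyEq
    (Filter.Eventually.of_forall fun t => ?_)
  simp [coordFun, h]

theorem pd_apply_fderiv {S : Finset (Coord m)} {f : DiffFun m} {g : (S → ℝ) → ℝ}
    (hg : Differentiable ℝ g) (hfg : ∀ θ : Jet m, f θ = g fun s => θ s)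
    (c : Coord m) (hc : c ∈ S) (θ : Jet m) :
    pd c f θ = fderiv ℝ g (fun s => θ s) (Pi.single ⟨c, hc⟩ 1) := by
  refine pd_apply_eq ?_
  have h1 : HasDerivAt (fun (t : ℝ) (s : S) => Function.update θ c t (s : Coord m))
      (Pi.single ⟨c, hc⟩ 1) (θ c) := by
    have h := hasDerivAt_update (𝕜 := ℝ) (fun s : S => θ s) ⟨c, hc⟩ (θ c)
    refine h.congr_of_eventuallyEq (Filter.Eventually.of_forall fun t => ?_)
    funext s
    by_cases hs : (s : Coord m) = c
    · obtain rfl : s = ⟨c, hc⟩ := Subtype.ext hs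
      simp
    · have hs' : s ≠ ⟨c, hc⟩ := fun h => hs (congrArg Subtype.val h)
      simp [hs, hs']
  have h2 : HasFDerivAt g (fderiv ℝ g fun s : S => θ s)
      (fun s : S => Function.update θ c (θ c) (s : Coord m)) := by
    simpa using (hg fun s : S => θ s).hasFDerivAt
  refine (h2.comp_hasDerivAt (θ c) h1).congr_of_eventuallyEq
    (Filter.Eventually.of_forall fun t => hfg _)

/-- Symmetry of second derivatives for differential functions. -/
theorem pd_comm (c d : Coord m) (f : DiffFun m) : pd c (pd d f) = pd d (pd c f) := by
  obtain ⟨S₀, hS₀⟩ := f.2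
  -- Enlarging the set of coordinates makes both `c` and `d` genuine variables of `g`.
  obtain ⟨g, hg, hfg⟩ := hS₀.mono (Finset.subset_union_left (s₂ := {c, d}))
  have hc : c ∈ S₀ ∪ {c, d} := by simp
  have hd : d ∈ S₀ ∪ {c, d} := by simp
  have hdiff : Differentiable ℝ g := hg.differentiable (by simp)
  have hg' : ContDiff ℝ ∞ (fderiv ℝ g) := hg.fderiv_right (by simp)
  have key (e e' : Coord m) (he : e ∈ S₀ ∪ {c, d}) (he' : e' ∈ S₀ ∪ {c, d}) (θ : Jet m) :
      pd e (pd e' f) θ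
        = fderiv ℝ (fderiv ℝ g) (fun s => θ s) (Pi.single ⟨e, he⟩ 1) (Pi.single ⟨e', he'⟩ 1) := by
    rw [pd_apply_fderiv (g := fun v => fderiv ℝ g v (Pi.single ⟨e', he'⟩ 1))
      ((hg'.clm_apply contDiff_const).differentiable (by simp))
      (fun θ => pd_apply_fderiv hdiff hfg e' he' θ) e he θ,
      fderiv_clm_apply (hg'.differentiable (by simp) _) (differentiableAt_const _)]
    simp
  refine DiffFun.ext fun θ => ?_
  rw [key c d hc hd, key d c hd hc]
  have hsym : IsSymmSndFDerivAt ℝ g fun s => θ s :=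
    hg.contDiffAt.isSymmSndFDerivAt (by
      rw [minSmoothness_of_isRCLikeNormedField]
      exact WithTop.coe_le_coe.2 (le_top : (2 : ℕ∞) ≤ ⊤))
  exact hsym _ _

/-! ### Vector fields on the jet space -/

/-- The vector field `∑_c X_c ∂/∂c` acting on differential functions. The sum is finite on each
differential function, whatever the coefficients `X`. -/
def vectorField (X : Coord m → DiffFun m) (f : DiffFun m) : DiffFun m :=
  ∑ᶠ c, X c * pd c f

theorem vectorField_eq_sum (X : Coord m → DiffFun m) {f : DiffFun m} {S : Finset (Coord m)}
    (hS : ∀ c ∉ S, pd c f = 0) : vectorField X f = ∑ c ∈ S, X c * pd c f := by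
  refine finsum_eq_sum_of_support_subset _ fun c hc => ?_
  by_contra h
  exact hc (by simp [hS c h])

theorem exists_finset_pd (f : DiffFun m) : ∃ S : Finset (Coord m), ∀ c ∉ S, pd c f = 0 :=
  ⟨(finite_pd f).toFinset, fun c hc => by simpa using hc⟩

theorem vectorField_add (X : Coord m → DiffFun m) (f g : DiffFun m) :
    vectorField X (f + g) = vectorField X f + vectorField X g := by
  classical
  obtain ⟨S, hS⟩ := exists_finset_pd f
  obtain ⟨T, hT⟩ := exists_finset_pd g
  have hf : ∀ c ∉ S ∪ T, pd c f = 0 := fun c hc => hS c (by simp_all)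
  have hg : ∀ c ∉ S ∪ T, pd c g = 0 := fun c hc => hT c (by simp_all)
  rw [vectorField_eq_sum X hf, vectorField_eq_sum X hg,
    vectorField_eq_sum X (S := S ∪ T) (fun c hc => by rw [pd_add, hf c hc, hg c hc, add_zero]),
    ← Finset.sum_add_distrib]
  exact Finset.sum_congr rfl fun c _ => by rw [pd_add, mul_add]

theorem vectorField_mul (X : Coord m → DiffFun m) (f g : DiffFun m) :
    vectorField X (f * g) = vectorField X f * g + f * vectorField X g := by
  classical
  obtain ⟨S, hS⟩ := exists_finset_pd f
  obtain ⟨T, hT⟩ := exists_finset_pd g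
  have hf : ∀ c ∉ S ∪ T, pd c f = 0 := fun c hc => hS c (by simp_all)
  have hg : ∀ c ∉ S ∪ T, pd c g = 0 := fun c hc => hT c (by simp_all)
  rw [vectorField_eq_sum X hf, vectorField_eq_sum X hg,
    vectorField_eq_sum X (S := S ∪ T)
      (fun c hc => by rw [pd_mul, hf c hc, hg c hc, zero_mul, mul_zero, add_zero]),
    Finset.sum_mul, Finset.mul_sum, ← Finset.sum_add_distrib]
  exact Finset.sum_congr rfl fun c _ => by rw [pd_mul]; ring

/-- A vector field as an additive map. -/
def vectorFieldHom (X : Coord m → DiffFun m) : DiffFun m →+ DiffFun m :=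
  AddMonoidHom.mk' (vectorField X) (vectorField_add X)

theorem vectorField_single (c : Coord m) (f : DiffFun m) :
    vectorField (Pi.single c 1) f = pd c f := by
  rw [vectorField, finsum_eq_single _ c fun d hd => by simp [hd]]
  simp

theorem vectorField_coordFun (X : Coord m → DiffFun m) (c : Coord m) :
    vectorField X (coordFun c) = X c := by
  rw [vectorField, finsum_eq_single _ c fun d hd => by rw [pd_coordFun_of_ne hd.symm, mul_zero],
    pd_coordFun_self, mul_one]

theorem vectorField_one (X : Coord m → DiffFun m) : vectorField X 1 = 0 := by
  simpa using vectorField_mul X 1 1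

theorem vectorField_zero (X : Coord m → DiffFun m) : vectorField X 0 = 0 :=
  map_zero (vectorFieldHom X)

/-- Only the first-order terms of the composite of two vector fields survive in the commutator,
because partial derivatives commute. -/
theorem vectorField_commutator (X Y : Coord m → DiffFun m) (f : DiffFun m) :
    vectorField X (vectorField Y f) - vectorField Y (vectorField X f)
      = vectorField (fun c => vectorField X (Y c) - vectorField Y (X c)) f := by
  obtain ⟨S, hS⟩ := exists_finset_pd f
  have hS2 (c : Coord m) : ∀ d ∉ S, pd d (pd c f) = 0 := fun d hd => by
    rw [pd_comm, hS d hd, pd_zero]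
  have comp (X Y : Coord m → DiffFun m) : vectorField X (vectorField Y f)
      = ∑ c ∈ S, vectorField X (Y c) * pd c f
        + ∑ c ∈ S, ∑ d ∈ S, Y c * (X d * pd d (pd c f)) := by
    rw [vectorField_eq_sum Y hS]
    refine (map_sum (vectorFieldHom X) _ S).trans ?_
    rw [← Finset.sum_add_distrib]
    refine Finset.sum_congr rfl fun c _ => (vectorField_mul X _ _).trans ?_
    rw [vectorField_eq_sum X (hS2 c), Finset.mul_sum]
  have symm : ∑ c ∈ S, ∑ d ∈ S, Y c * (X d * pd d (pd c f))
      = ∑ c ∈ S, ∑ d ∈ S, X c * (Y d * pd d (pd c f)) := by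
    rw [Finset.sum_comm]
    refine Finset.sum_congr rfl fun c _ => Finset.sum_congr rfl fun d _ => ?_
    rw [pd_comm]
    ring
  rw [comp X Y, comp Y X, symm, vectorField_eq_sum _ hS, add_sub_add_right_eq_sub,
    ← Finset.sum_sub_distrib]
  exact Finset.sum_congr rfl fun c _ => (sub_mul _ _ _).symm

theorem pd_vectorField_sub (e : Coord m) (X : Coord m → DiffFun m) (f : DiffFun m) :
    pd e (vectorField X f) - vectorField X (pd e f) = vectorField (fun c => pd e (X c)) f := by
  have h := vectorField_commutator (Pi.single e 1) X f
  simp only [vectorField_single] at h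
  rw [h]
  congr 1
  funext c
  by_cases hc : c = e
  · subst hc
    simp [vectorField_one]
  · simp [hc, vectorField_zero]

/-! ### Total derivatives -/

/-- The coefficients of the total derivative `D_x`. -/
def coeffDx : Coord m → DiffFun m
  | .x => 1
  | .y => 0
  | .u k a b => coordFun (.u k (a + 1) b)

/-- The coefficients of the total derivative `D_y`. -/
def coeffDy : Coord m → DiffFun m
  | .x => 0
  | .y => 1
  | .u k a b => coordFun (.u k a (b + 1))

theorem vectorField_eq_add_finsum (X : Coord m → DiffFun m) (f : DiffFun m) :
    vectorField X f = X .x * pd .x f + X .y * pd .y f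
      + ∑ᶠ i : Fin m × ℕ × ℕ, X (.u i.1 i.2.1 i.2.2) * pd (.u i.1 i.2.1 i.2.2) f := by
  have hfin (s : Set (Coord m)) : (s ∩ Function.support fun c => X c * pd c f).Finite :=
    (finite_pd f).subset fun c hc h => hc.2 (by simp [h])
  have huniv : (Set.univ : Set (Coord m)) = ({.x} ∪ {.y}) ∪
      Set.range fun i : Fin m × ℕ × ℕ => (.u i.1 i.2.1 i.2.2 : Coord m) := by
    ext c
    cases c <;> simp
  rw [vectorField, ← finsum_mem_univ, huniv, finsum_mem_union' _ (hfin _) (hfin _),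
    finsum_mem_union' _ (hfin _) (hfin _), finsum_mem_singleton, finsum_mem_singleton,
    finsum_mem_range u_injective]
  · simp
  · rw [Set.disjoint_left]
    rintro c (rfl | rfl) <;> simp

theorem Dx_eq_vectorField (f : DiffFun m) : Dx f = vectorField coeffDx f := by
  rw [vectorField_eq_add_finsum]
  simp [Dx, coeffDx]

theorem Dy_eq_vectorField (f : DiffFun m) : Dy f = vectorField coeffDy f := by
  rw [vectorField_eq_add_finsum]
  simp [Dy, coeffDy]

theorem Dx_add (f g : DiffFun m) : Dx (f + g) = Dx f + Dx g := by
  simp only [Dx_eq_vectorField, vectorField_add]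

theorem Dy_add (f g : DiffFun m) : Dy (f + g) = Dy f + Dy g := by
  simp only [Dy_eq_vectorField, vectorField_add]

theorem Dx_mul (f g : DiffFun m) : Dx (f * g) = Dx f * g + f * Dx g := by
  simp only [Dx_eq_vectorField, vectorField_mul]

theorem Dy_mul (f g : DiffFun m) : Dy (f * g) = Dy f * g + f * Dy g := by
  simp only [Dy_eq_vectorField, vectorField_mul]

/-- Total derivatives commute. -/
theorem Dx_Dy (f : DiffFun m) : Dx (Dy f) = Dy (Dx f) := by
  simp only [Dx_eq_vectorField, Dy_eq_vectorField]
  rw [← sub_eq_zero, vectorField_commutator]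
  refine (finsum_congr fun c => ?_).trans finsum_zero
  cases c <;> simp [coeffDx, coeffDy, vectorField_one, vectorField_zero, vectorField_coordFun]

theorem pd_Dx_zero (k : Fin m) (b : ℕ) (f : DiffFun m) :
    pd (.u k 0 b) (Dx f) = Dx (pd (.u k 0 b) f) := by
  simp only [Dx_eq_vectorField]
  rw [← sub_eq_zero, pd_vectorField_sub]
  refine (finsum_congr fun c => ?_).trans finsum_zero
  cases c <;> simp [coeffDx, pd_one, pd_zero, pd_coordFun_of_ne]

theorem pd_Dx_succ (k : Fin m) (a b : ℕ) (f : DiffFun m) :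
    pd (.u k (a + 1) b) (Dx f) = Dx (pd (.u k (a + 1) b) f) + pd (.u k a b) f := by
  simp only [Dx_eq_vectorField]
  rw [← sub_eq_iff_eq_add', pd_vectorField_sub, ← vectorField_single (.u k a b)]
  congr 1
  funext c
  by_cases h : c = .u k a b
  · subst h
    simp [coeffDx, pd_coordFun_self]
  · rw [Pi.single_eq_of_ne h]
    cases c with
    | x => exact pd_one _
    | y => exact pd_zero _
    | u k' a' b' => exact pd_coordFun_of_ne (by simpa using h)

theorem pd_Dy_zero (k : Fin m) (a : ℕ) (f : DiffFun m) :
    pd (.u k a 0) (Dy f) = Dy (pd (.u k a 0) f) := by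
  simp only [Dy_eq_vectorField]
  rw [← sub_eq_zero, pd_vectorField_sub]
  refine (finsum_congr fun c => ?_).trans finsum_zero
  cases c <;> simp [coeffDy, pd_one, pd_zero, pd_coordFun_of_ne]

theorem pd_Dy_succ (k : Fin m) (a b : ℕ) (f : DiffFun m) :
    pd (.u k a (b + 1)) (Dy f) = Dy (pd (.u k a (b + 1)) f) + pd (.u k a b) f := by
  simp only [Dy_eq_vectorField]
  rw [← sub_eq_iff_eq_add', pd_vectorField_sub, ← vectorField_single (.u k a b)]
  congr 1
  funext c
  by_cases h : c = .u k a b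
  · subst h
    simp [coeffDy, pd_coordFun_self]
  · rw [Pi.single_eq_of_ne h]
    cases c with
    | x => exact pd_zero _
    | y => exact pd_one _
    | u k' a' b' => exact pd_coordFun_of_ne (by simpa using h)

/-! ### The differential ideal is stable under total derivatives -/

theorem Dy_iterate_Dx (a : ℕ) (f : DiffFun m) : Dy (Dx^[a] f) = Dx^[a] (Dy f) :=
  (Function.Commute.iterate_right (f := Dy) (g := Dx) (fun f => (Dx_Dy f).symm) a) f

theorem mem_span_of_derivation {R : Type*} [CommRing R] {s : Set R} {D : R → R}
    (hadd : ∀ f g, D (f + g) = D f + D g) (hmul : ∀ f g, D (f * g) = D f * g + f * D g)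
    (hs : ∀ f ∈ s, D f ∈ Ideal.span s) {f : R} (hf : f ∈ Ideal.span s) : D f ∈ Ideal.span s := by
  induction hf using Submodule.span_induction with
  | mem f hf => exact hs f hf
  | zero =>
    have h : D 0 = 0 := by simpa using hadd 0 0
    rw [h]
    exact zero_mem _
  | add f g _ _ hf hg =>
    rw [hadd]
    exact add_mem hf hg
  | smul r f hf' hf =>
    rw [smul_eq_mul, hmul]
    exact add_mem (Ideal.mul_mem_left _ _ hf') (Ideal.mul_mem_left _ _ hf)

theorem Dx_mem_eqIdeal {F : Fin N → DiffFun m} {f : DiffFun m} (hf : f ∈ eqIdeal F) :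
    Dx f ∈ eqIdeal F := by
  refine mem_span_of_derivation Dx_add Dx_mul ?_ hf
  rintro _ ⟨l, a, b, rfl⟩
  exact Ideal.subset_span ⟨l, a + 1, b, (Function.iterate_succ_apply' _ _ _).symm⟩

theorem Dy_mem_eqIdeal {F : Fin N → DiffFun m} {f : DiffFun m} (hf : f ∈ eqIdeal F) :
    Dy f ∈ eqIdeal F := by
  refine mem_span_of_derivation Dy_add Dy_mul ?_ hf
  rintro _ ⟨l, a, b, rfl⟩
  exact Ideal.subset_span
    ⟨l, a, b + 1, by rw [Dy_iterate_Dx, Function.iterate_succ_apply']⟩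

/-! ### Covariant total derivatives of `𝔤`-valued functions -/

theorem GFun.ext {M M' : GFun m 𝔤} (h : ∀ i j, (M : MatFun m n) i j = (M' : MatFun m n) i j) :
    M = M' :=
  Subtype.ext (Matrix.ext h)

theorem GFun.lie_apply (M M' : GFun m 𝔤) (i j : Fin n) :
    ((⁅M, M'⁆ : GFun m 𝔤) : MatFun m n) i j
      = ∑ s, ((M : MatFun m n) i s * (M' : MatFun m n) s j
          - (M' : MatFun m n) i s * (M : MatFun m n) s j) := by
  rw [Finset.sum_sub_distrib]
  rfl

/-- A derivation applied entrywise is a derivation of the matrix commutator. -/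
theorem derivation_lie_apply (D : DiffFun m →+ DiffFun m)
    (hmul : ∀ f g, D (f * g) = D f * g + f * D g) {M M' DM DM' : GFun m 𝔤}
    (hM : ∀ i j, (DM : MatFun m n) i j = D ((M : MatFun m n) i j))
    (hM' : ∀ i j, (DM' : MatFun m n) i j = D ((M' : MatFun m n) i j)) (i j : Fin n) :
    D (((⁅M, M'⁆ : GFun m 𝔤) : MatFun m n) i j)
      = ((⁅DM, M'⁆ + ⁅M, DM'⁆ : GFun m 𝔤) : MatFun m n) i j := by
  have h : ((⁅DM, M'⁆ + ⁅M, DM'⁆ : GFun m 𝔤) : MatFun m n) i j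
      = ((⁅DM, M'⁆ : GFun m 𝔤) : MatFun m n) i j
        + ((⁅M, DM'⁆ : GFun m 𝔤) : MatFun m n) i j := rfl
  rw [h, GFun.lie_apply, GFun.lie_apply, GFun.lie_apply, map_sum, ← Finset.sum_add_distrib]
  refine Finset.sum_congr rfl fun s _ => ?_
  rw [map_sub, hmul, hmul, hM, hM, hM', hM']
  ring

theorem gpd_add (c : Coord m) (M M' : GFun m 𝔤) : gpd c (M + M') = gpd c M + gpd c M' :=
  GFun.ext fun _ _ => pd_add c _ _

theorem gDx_add (M M' : GFun m 𝔤) : gDx (M + M') = gDx M + gDx M' :=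
  GFun.ext fun _ _ => Dx_add _ _

theorem gDy_add (M M' : GFun m 𝔤) : gDy (M + M') = gDy M + gDy M' :=
  GFun.ext fun _ _ => Dy_add _ _

theorem gpd_sub (c : Coord m) (M M' : GFun m 𝔤) : gpd c (M - M') = gpd c M - gpd c M' :=
  map_sub (AddMonoidHom.mk' (gpd (𝔤 := 𝔤) c) (gpd_add c)) M M'

theorem gDx_sub (M M' : GFun m 𝔤) : gDx (M - M') = gDx M - gDx M' :=
  map_sub (AddMonoidHom.mk' (gDx (𝔤 := 𝔤)) gDx_add) M M'

theorem gDy_sub (M M' : GFun m 𝔤) : gDy (M - M') = gDy M - gDy M' :=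
  map_sub (AddMonoidHom.mk' (gDy (𝔤 := 𝔤)) gDy_add) M M'

theorem gpd_lie (c : Coord m) (M M' : GFun m 𝔤) :
    gpd c ⁅M, M'⁆ = ⁅gpd c M, M'⁆ + ⁅M, gpd c M'⁆ :=
  GFun.ext fun i j => derivation_lie_apply (AddMonoidHom.mk' (pd c) (pd_add c)) (pd_mul c)
    (fun _ _ => rfl) (fun _ _ => rfl) i j

theorem gDx_lie (M M' : GFun m 𝔤) : gDx ⁅M, M'⁆ = ⁅gDx M, M'⁆ + ⁅M, gDx M'⁆ :=
  GFun.ext fun i j => derivation_lie_apply (AddMonoidHom.mk' Dx Dx_add) Dx_mul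
    (fun _ _ => rfl) (fun _ _ => rfl) i j

theorem gDy_lie (M M' : GFun m 𝔤) : gDy ⁅M, M'⁆ = ⁅gDy M, M'⁆ + ⁅M, gDy M'⁆ :=
  GFun.ext fun i j => derivation_lie_apply (AddMonoidHom.mk' Dy Dy_add) Dy_mul
    (fun _ _ => rfl) (fun _ _ => rfl) i j

theorem gDx_gDy (M : GFun m 𝔤) : gDx (gDy M) = gDy (gDx M) :=
  GFun.ext fun _ _ => Dx_Dy _

/-- The covariant derivative `D̂_x = D_x - ad_A` as an additive map. -/
def hatDxHom (A : GFun m 𝔤) : GFun m 𝔤 →+ GFun m 𝔤 :=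
  AddMonoidHom.mk' (hatDx A) fun M M' => by
    simp only [hatDx, gDx_add, lie_add]
    abel

/-- The covariant derivative `D̂_y = D_y - ad_B` as an additive map. -/
def hatDyHom (B : GFun m 𝔤) : GFun m 𝔤 →+ GFun m 𝔤 :=
  AddMonoidHom.mk' (hatDy B) fun M M' => by
    simp only [hatDy, gDy_add, lie_add]
    abel

/-- The operator `D̂_I`, `I = (a, b)`, as an additive map. -/
def hatDHom (A B : GFun m 𝔤) (a b : ℕ) : GFun m 𝔤 →+ GFun m 𝔤 :=
  AddMonoidHom.mk' (hatD A B a b) fun M M' => by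
    have h1 := iterate_map_add (hatDyHom B) b M M'
    have h2 := iterate_map_add (hatDxHom A) a ((hatDy B)^[b] M) ((hatDy B)^[b] M')
    exact (congrArg (hatDx A)^[a] h1).trans h2

/-- The curvature of the connection `(D̂_x, D̂_y)` is the adjoint action of the Maurer-Cartan
expression. -/
theorem hatDx_hatDy_sub (A B M : GFun m 𝔤) :
    hatDx A (hatDy B M) - hatDy B (hatDx A M) = ⁅maurerCartan A B, M⁆ := by
  simp only [hatDx, hatDy, maurerCartan, gDx_sub, gDy_sub, gDx_lie, gDy_lie, gDx_gDy, lie_sub,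
    sub_lie, add_lie, lie_lie]
  abel

/-! ### Linearization of the Maurer-Cartan expression -/

/-- The partial derivative `∂/∂u^k_{a-1,b}`, read as zero for `a = 0`. -/
def gpdPredX (k : Fin m) (b : ℕ) (M : GFun m 𝔤) : ℕ → GFun m 𝔤
  | 0 => 0
  | a + 1 => gpd (.u k a b) M

/-- The partial derivative `∂/∂u^k_{a,b-1}`, read as zero for `b = 0`. -/
def gpdPredY (k : Fin m) (a : ℕ) (M : GFun m 𝔤) : ℕ → GFun m 𝔤
  | 0 => 0
  | b + 1 => gpd (.u k a b) M

theorem gpd_gDx (k : Fin m) (a b : ℕ) (M : GFun m 𝔤) :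
    gpd (.u k a b) (gDx M) = gDx (gpd (.u k a b) M) + gpdPredX k b M a := by
  cases a with
  | zero => exact (GFun.ext fun _ _ => pd_Dx_zero k b _).trans (add_zero _).symm
  | succ a => exact GFun.ext fun _ _ => pd_Dx_succ k a b _

theorem gpd_gDy (k : Fin m) (a b : ℕ) (M : GFun m 𝔤) :
    gpd (.u k a b) (gDy M) = gDy (gpd (.u k a b) M) + gpdPredY k a M b := by
  cases b with
  | zero => exact (GFun.ext fun _ _ => pd_Dy_zero k a _).trans (add_zero _).symm
  | succ b => exact GFun.ext fun _ _ => pd_Dy_succ k a b _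

theorem gpd_maurerCartan (A B : GFun m 𝔤) (k : Fin m) (a b : ℕ) :
    gpd (.u k a b) (maurerCartan A B)
      = (hatDy B (gpd (.u k a b) A) + gpdPredY k a A b)
        - (hatDx A (gpd (.u k a b) B) + gpdPredX k b B a) := by
  rw [maurerCartan, gpd_add, gpd_sub, gpd_gDx, gpd_gDy, gpd_lie, hatDx, hatDy,
    ← lie_skew B (gpd (.u k a b) A)]
  abel

/-- The derivatives along jet variables of sufficiently high order vanish. -/
theorem exists_gpd_eq_zero (M : GFun m 𝔤) (k : Fin m) :
    ∃ L : ℕ, ∀ a b, L ≤ a ∨ L ≤ b → gpd (.u k a b) M = 0 := by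
  have hfin : (⋃ i, ⋃ j, {c | pd c ((M : MatFun m n) i j) ≠ 0}).Finite :=
    Set.finite_iUnion fun i => Set.finite_iUnion fun j => finite_pd _
  have hinj : Function.Injective fun I : ℕ × ℕ => (.u k I.1 I.2 : Coord m) := by
    rintro ⟨a, b⟩ ⟨a', b'⟩ h
    simpa using h
  obtain ⟨⟨p, q⟩, hpq⟩ := (hfin.preimage hinj.injOn).bddAbove
  refine ⟨p + q + 1, fun a b hab => GFun.ext fun i j => ?_⟩
  by_contra h
  have hmem : (a, b) ≤ (p, q) := hpq (Set.mem_iUnion.2 ⟨i, Set.mem_iUnion.2 ⟨j, h⟩⟩)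
  have h1 : a ≤ p := hmem.1
  have h2 : b ≤ q := hmem.2
  omega

theorem hatEuler_eq_sum (A B : GFun m 𝔤) (k : Fin m) (M : GFun m 𝔤) {L : ℕ}
    (hL : ∀ a b, L ≤ a ∨ L ≤ b → gpd (.u k a b) M = 0) :
    hatEuler A B k M = ∑ a ∈ Finset.range L, ∑ b ∈ Finset.range L,
      (-1 : ℤ) ^ (a + b) • hatD A B a b (gpd (.u k a b) M) := by
  rw [← Finset.sum_product']
  refine finsum_eq_sum_of_support_subset _ fun I hI => ?_
  by_contra h
  refine hI ?_
  have h0 : gpd (.u k I.1 I.2) M = 0 := by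
    refine hL _ _ ?_
    simp only [Finset.coe_product, Finset.coe_range, Set.mem_prod, Set.mem_Iio] at h
    omega
  have h1 : hatD A B I.1 I.2 (0 : GFun m 𝔤) = 0 := map_zero (hatDHom A B I.1 I.2)
  simp only [h0, h1, smul_zero]

/-! ### Telescoping modulo the differential ideal -/

theorem restr_eq_zero_iff {F : Fin N → DiffFun m} {M : GFun m 𝔤} :
    restr F M = 0 ↔ M ∈ gIdeal 𝔤 F :=
  LieSubmodule.Quotient.mk_eq_zero'

theorem hatDx_mem_gIdeal {F : Fin N → DiffFun m} (A : GFun m 𝔤) {M : GFun m 𝔤}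
    (hM : M ∈ gIdeal 𝔤 F) : hatDx A M ∈ gIdeal 𝔤 F :=
  sub_mem (show gDx M ∈ gIdeal 𝔤 F from fun i j => Dx_mem_eqIdeal (hM i j))
    ((gIdeal 𝔤 F).lie_mem hM)

theorem hatDy_mem_gIdeal {F : Fin N → DiffFun m} (B : GFun m 𝔤) {M : GFun m 𝔤}
    (hM : M ∈ gIdeal 𝔤 F) : hatDy B M ∈ gIdeal 𝔤 F :=
  sub_mem (show gDy M ∈ gIdeal 𝔤 F from fun i j => Dy_mem_eqIdeal (hM i j))
    ((gIdeal 𝔤 F).lie_mem hM)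

theorem iterate_hatDx_mem_gIdeal {F : Fin N → DiffFun m} (A : GFun m 𝔤) (a : ℕ) {M : GFun m 𝔤}
    (hM : M ∈ gIdeal 𝔤 F) : (hatDx A)^[a] M ∈ gIdeal 𝔤 F := by
  induction a with
  | zero => exact hM
  | succ a ih =>
    rw [Function.iterate_succ_apply']
    exact hatDx_mem_gIdeal A ih

/-- On the equation the connection is flat, so `D̂_x` commutes with the powers of `D̂_y`. -/
theorem iterate_hatDy_hatDx_sub_mem {F : Fin N → DiffFun m} {A B : GFun m 𝔤}
    (hC : maurerCartan A B ∈ gIdeal 𝔤 F) (b : ℕ) (M : GFun m 𝔤) :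
    (hatDy B)^[b] (hatDx A M) - hatDx A ((hatDy B)^[b] M) ∈ gIdeal 𝔤 F := by
  induction b with
  | zero => simp
  | succ b ih =>
    rw [Function.iterate_succ_apply', Function.iterate_succ_apply']
    set P := (hatDy B)^[b] M
    have h1 := hatDy_mem_gIdeal B ih
    have h2 : hatDy B ((hatDy B)^[b] (hatDx A M) - hatDx A P)
        = hatDy B ((hatDy B)^[b] (hatDx A M)) - hatDy B (hatDx A P) := map_sub (hatDyHom B) _ _
    have h3 : ⁅maurerCartan A B, P⁆ ∈ gIdeal 𝔤 F := lie_mem_left _ _ _ _ _ hC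
    rw [← hatDx_hatDy_sub] at h3
    rw [h2] at h1
    convert sub_mem h1 h3 using 1
    abel

theorem hatD_hatDx_sub_mem {F : Fin N → DiffFun m} {A B : GFun m 𝔤}
    (hC : maurerCartan A B ∈ gIdeal 𝔤 F) (a b : ℕ) (M : GFun m 𝔤) :
    hatD A B a b (hatDx A M) - hatD A B (a + 1) b M ∈ gIdeal 𝔤 F := by
  have h := iterate_hatDx_mem_gIdeal A a (iterate_hatDy_hatDx_sub_mem hC b M)
  have h2 := iterate_map_sub (hatDxHom A) a
    ((hatDy B)^[b] (hatDx A M)) (hatDx A ((hatDy B)^[b] M))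
  exact (congrArg (· ∈ gIdeal 𝔤 F) h2).mp h

theorem hatD_hatDy (A B : GFun m 𝔤) (a b : ℕ) (M : GFun m 𝔤) :
    hatD A B a b (hatDy B M) = hatD A B a (b + 1) M := rfl

/-- The part of the gauge Euler operator coming from `D_y A + [A, B]` telescopes in `b`. -/
theorem sum_hatD_gpd_y_eq_zero (A B M : GFun m 𝔤) (k : Fin m) (a : ℕ) {L : ℕ}
    (hL : gpd (.u k a L) M = 0) :
    ∑ b ∈ Finset.range (L + 1), (-1 : ℤ) ^ (a + b) •
      hatD A B a b (hatDy B (gpd (.u k a b) M) + gpdPredY k a M b) = 0 := by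
  have hz (b : ℕ) : hatD A B a b (0 : GFun m 𝔤) = 0 := map_zero (hatDHom A B a b)
  have ht (b : ℕ) : (-1 : ℤ) ^ (a + b) •
      hatD A B a b (hatDy B (gpd (.u k a b) M) + gpdPredY k a M b)
      = (-1 : ℤ) ^ (a + b) • hatD A B a b (gpdPredY k a M b)
        - (-1 : ℤ) ^ (a + (b + 1)) • hatD A B a (b + 1) (gpdPredY k a M (b + 1)) := by
    have h : hatD A B a b (hatDy B (gpd (.u k a b) M) + gpdPredY k a M b)
        = hatD A B a b (hatDy B (gpd (.u k a b) M)) + hatD A B a b (gpdPredY k a M b) :=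
      map_add (hatDHom A B a b) _ _
    rw [h, hatD_hatDy, gpdPredY, ← add_assoc, pow_succ, mul_neg_one, neg_smul, smul_add]
    abel
  rw [Finset.sum_congr rfl fun b _ => ht b, Finset.sum_range_sub', gpdPredY, gpdPredY, hL, hz, hz,
    smul_zero, smul_zero, sub_zero]

/-- The part of the gauge Euler operator coming from `-D_x B + [A, B]` telescopes in `a`, up to
the commutators of `D̂_x` with powers of `D̂_y`, which lie in the ideal of the equation. -/
theorem sum_hatD_gpd_x_mem {F : Fin N → DiffFun m} {A B : GFun m 𝔤}
    (hC : maurerCartan A B ∈ gIdeal 𝔤 F) (M : GFun m 𝔤) (k : Fin m) (b : ℕ) {L : ℕ}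
    (hL : gpd (.u k L b) M = 0) :
    ∑ a ∈ Finset.range (L + 1), (-1 : ℤ) ^ (a + b) •
      hatD A B a b (hatDx A (gpd (.u k a b) M) + gpdPredX k b M a) ∈ gIdeal 𝔤 F := by
  have hz (a : ℕ) : hatD A B a b (0 : GFun m 𝔤) = 0 := map_zero (hatDHom A B a b)
  have ht (a : ℕ) : (-1 : ℤ) ^ (a + b) •
      hatD A B a b (hatDx A (gpd (.u k a b) M) + gpdPredX k b M a)
      = (-1 : ℤ) ^ (a + b) • (hatD A B a b (hatDx A (gpd (.u k a b) M))
          - hatD A B (a + 1) b (gpd (.u k a b) M))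
        + ((-1 : ℤ) ^ (a + b) • hatD A B a b (gpdPredX k b M a)
        - (-1 : ℤ) ^ (a + 1 + b) • hatD A B (a + 1) b (gpdPredX k b M (a + 1))) := by
    have h : hatD A B a b (hatDx A (gpd (.u k a b) M) + gpdPredX k b M a)
        = hatD A B a b (hatDx A (gpd (.u k a b) M)) + hatD A B a b (gpdPredX k b M a) :=
      map_add (hatDHom A B a b) _ _
    rw [h, gpdPredX, add_right_comm a 1 b, pow_succ, mul_neg_one, neg_smul, smul_add, smul_sub]
    abel
  have htel : ∑ a ∈ Finset.range (L + 1),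
      ((-1 : ℤ) ^ (a + b) • hatD A B a b (gpdPredX k b M a)
        - (-1 : ℤ) ^ (a + 1 + b) • hatD A B (a + 1) b (gpdPredX k b M (a + 1))) = 0 := by
    rw [Finset.sum_range_sub' fun a => (-1 : ℤ) ^ (a + b) • hatD A B a b (gpdPredX k b M a),
      gpdPredX, gpdPredX, hL, hz, hz, smul_zero, smul_zero, sub_zero]
  rw [Finset.sum_congr rfl fun a _ => ht a, Finset.sum_add_distrib, htel, add_zero]
  exact sum_mem fun a _ => zsmul_mem (hatD_hatDx_sub_mem hC a b _) _

theorem hatEuler_maurerCartan_mem {F : Fin N → DiffFun m} {A B : GFun m 𝔤}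
    (hC : maurerCartan A B ∈ gIdeal 𝔤 F) (k : Fin m) :
    hatEuler A B k (maurerCartan A B) ∈ gIdeal 𝔤 F := by
  obtain ⟨LA, hA⟩ := exists_gpd_eq_zero A k
  obtain ⟨LB, hB⟩ := exists_gpd_eq_zero B k
  obtain ⟨LC, hC'⟩ := exists_gpd_eq_zero (maurerCartan A B) k
  set L := LA + LB + LC with hL
  rw [hatEuler_eq_sum A B k (maurerCartan A B) (L := L + 1) fun a b h => hC' a b (by omega)]
  have ht (a b : ℕ) : (-1 : ℤ) ^ (a + b) • hatD A B a b (gpd (.u k a b) (maurerCartan A B))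
      = (-1 : ℤ) ^ (a + b) • hatD A B a b (hatDy B (gpd (.u k a b) A) + gpdPredY k a A b)
        - (-1 : ℤ) ^ (a + b) • hatD A B a b (hatDx A (gpd (.u k a b) B) + gpdPredX k b B a) := by
    rw [gpd_maurerCartan, ← smul_sub]
    exact congrArg _ (map_sub (hatDHom A B a b) _ _)
  simp only [ht, Finset.sum_sub_distrib]
  refine sub_mem ?_ ?_
  · refine sum_mem fun a _ => ?_
    rw [sum_hatD_gpd_y_eq_zero A B A k a (hA a L (by omega))]
    exact zero_mem _
  · rw [Finset.sum_comm]
    exact sum_mem fun b _ => sum_hatD_gpd_x_mem hC B k b (hB L b (by omega))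

theorem sum_smul_mem_gIdeal (F : Fin N → DiffFun m) (Q : Fin N → GFun m 𝔤) :
    ∑ l, F l • Q l ∈ gIdeal 𝔤 F := by
  refine sum_mem fun l _ => ?_
  have hF : F l ∈ eqIdeal F := Ideal.subset_span ⟨l, 0, 0, rfl⟩
  exact fun i j => (eqIdeal F).mul_mem_right _ hF

end

end ZCR

theorem proposition4p4 (m N n : ℕ)
    (𝔤 : LieSubalgebra ℝ (Matrix (Fin n) (Fin n) ℝ))
    (F : Fin N → ZCR.DiffFun m)
    (α β : ZCR.GFunOn 𝔤 F) (hZCR : ZCR.IsZCR F α β)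
    (A B : ZCR.GFun m 𝔤) (hAB : ZCR.IsCharRep F α β A B) (k : Fin m) :
    ZCR.restr F (ZCR.hatEuler A B k (ZCR.maurerCartan A B)) = 0 := by
  obtain ⟨-, -, Q, hQ⟩ := hAB
  rw [ZCR.restr_eq_zero_iff]
  refine ZCR.hatEuler_maurerCartan_mem ?_ k
  rw [hQ]
  exact ZCR.sum_smul_mem_gIdeal F Q
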